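/- Let $q$ be a formal variable and, for $k \ge 1$, put $$f_k := (q^k;q^k)_\infty = \prod_{i \ge 1} (1 - q^{ki}) \in \mathbb{Z}[[q]].$$ Let the integers $M(n)$, $n \ge 0$, be defined by $$\sum_{n \ge 0} M(n) q^n = \frac{f_2^5 f_5^5}{f_1 f_{10}}.$$ Then for every integer $\alpha \ge 1$, $$\sum_{n \ge 0} M(5^{\alpha} n + 5^{\alpha} - 1)\, q^n = 5^{\alpha}\, \Psi_{\alpha}, \qquad \text{where} \quad \Psi_{\alpha} = \begin{cases} q\,\dfrac{f_1^5 f_{10}^5}{f_2 f_5}, & \alpha \text{ odd}, \\[10pt] \dfrac{f_2^5 f_5^5}{f_1 f_{10}}, & \alpha \text{ even}. \end{cases}$$ -/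

import Mathlib

namespace QSeries

open PowerSeries

section

open scoped PowerSeries.WithPiTopology

/-- The infinite `q`-Pochhammer symbol `(a; q)_∞ = ∏_{i ≥ 0} (1 - a q^i)`, for formal power series
`a`, `q` with integer coefficients. The infinite product is taken in the topology of
coefficientwise convergence on `ℤ⟦X⟧` (with `ℤ` discrete). -/
noncomputable def qPochhammerInf (a q : ℤ⟦X⟧) : ℤ⟦X⟧ :=
  ∏' i : ℕ, (1 - a * q ^ i)

/-- `f_k = (q^k; q^k)_∞`, the variable `q` being the formal variable `X`. -/
noncomputable def f (k : ℕ) : ℤ⟦X⟧ :=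
  qPochhammerInf (X ^ k) (X ^ k)

/-- For `k ≥ 1` the product that defines `f_k` converges, so `f_k` is not a junk value. -/
theorem multipliable_f {k : ℕ} (hk : 1 ≤ k) :
    Multipliable fun i : ℕ => (1 : ℤ⟦X⟧) - X ^ k * (X ^ k) ^ i := by
  have h : (fun i : ℕ => (1 : ℤ⟦X⟧) - X ^ k * (X ^ k) ^ i)
      = fun i : ℕ => 1 + -(X ^ (k * (i + 1)) : ℤ⟦X⟧) := by
    funext i
    rw [sub_eq_add_neg, ← pow_mul, ← pow_add, Nat.mul_succ, add_comm k]
  rw [h]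
  apply WithPiTopology.multipliable_one_add_of_tendsto_order_atTop_nhds_top
  refine ENat.tendsto_nhds_top_iff_natCast_lt.mpr fun n => ?_
  filter_upwards [Filter.eventually_ge_atTop n] with i hi
  rw [order_neg, order_X_pow]
  exact_mod_cast (by nlinarith : n < k * (i + 1))

theorem constantCoeff_f {k : ℕ} (hk : 1 ≤ k) : constantCoeff (f k) = 1 := by
  unfold f qPochhammerInf
  rw [(multipliable_f hk).map_tprod (constantCoeff (R := ℤ))
    (WithPiTopology.continuous_constantCoeff ℤ)]
  have hk0 : k ≠ 0 := by omega
  simp [hk0]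

end

/-- The quotient `A / B` of formal power series over `ℤ`, for `B` with constant coefficient `1`. -/
noncomputable def quot (A B : ℤ⟦X⟧) : ℤ⟦X⟧ :=
  A * invOfUnit B 1

/-- `quot A B` is the true quotient whenever `B` has constant coefficient `1`. -/
theorem quot_mul_cancel (A : ℤ⟦X⟧) {B : ℤ⟦X⟧} (hB : constantCoeff B = 1) :
    quot A B * B = A := by
  rw [quot, mul_assoc, invOfUnit_mul B 1 (by simpa using hB), mul_one]

/-- The integers `M(n)`, defined by `∑_{n ≥ 0} M(n) q^n = f_2^5 f_5^5 / (f_1 f_10)`. -/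
noncomputable def M (n : ℕ) : ℤ :=
  coeff n (quot (f 2 ^ 5 * f 5 ^ 5) (f 1 * f 10))

/-- `Ψ_α` is `q f_1^5 f_10^5 / (f_2 f_5)` for odd `α` and `f_2^5 f_5^5 / (f_1 f_10)` for
even `α`. -/
noncomputable def Psi (α : ℕ) : ℤ⟦X⟧ :=
  if Odd α then X * quot (f 1 ^ 5 * f 10 ^ 5) (f 2 * f 5)
  else quot (f 2 ^ 5 * f 5 ^ 5) (f 1 * f 10)

end QSeries

namespace QSeries

open PowerSeries Finset

/-! Put ψ(q) = f_2^5/f_1 and φ(q) = f_1^5/f_2. The generating function of M is ψ(q) φ(q^5), and q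
f_1^5 f_10^5/(f_2 f_5) is q φ(q) ψ(q^5). Let U extract the exponents ≡ 4 mod 5; then U(F(q) G(q^5))
= U(F) G. Everything follows from U(ψ) = 5q ψ(q^5) and U(qφ) = 5 φ(q^5): each application of U gains
a factor 5 and exchanges the two forms of `Psi`.

For these two rules, the identities of Jacobi and Gauss write ψ and φ as products of two theta
series. After completing squares, the relevant exponents satisfy a binary quadratic form ≡ 0 mod 5,
anisotropic there, so both variables are divisible by 5. Those terms reproduce the series in q^25,
and Jacobi's weight 2k+1 contributes the factor 5. The Jacobi and Gauss identities are limits of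
finite triple products specialised at z = ±1. -/

/-! ### Triangular numbers and finite q-products. -/

/-- The triangular number `k (k + 1) / 2`. -/
def tri (k : ℕ) : ℕ := k * (k + 1) / 2

theorem two_mul_tri (k : ℕ) : 2 * tri k = k * (k + 1) := by
  obtain ⟨m, hm⟩ := Nat.even_mul_succ_self k
  rw [tri]
  omega

theorem tri_succ (k : ℕ) : tri (k + 1) = tri k + (k + 1) := by
  have h1 := two_mul_tri k
  have h2 := two_mul_tri (k + 1)
  nlinarith

theorem le_tri (k : ℕ) : k ≤ tri k := by
  have h := two_mul_tri k
  nlinarith [Nat.le_mul_self k]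

theorem tri_injective : Function.Injective tri := by
  refine (strictMono_nat_of_lt_succ fun k => ?_).injective
  rw [tri_succ]
  omega

/-- The finite product `(q^k; q^k)_n`. -/
noncomputable def qprod (k n : ℕ) : ℤ⟦X⟧ :=
  ∏ i ∈ range n, (1 - X ^ (k * (i + 1)))

@[simp]
theorem qprod_zero (k : ℕ) : qprod k 0 = 1 := by
  simp [qprod]

theorem qprod_succ (k n : ℕ) : qprod k (n + 1) = qprod k n * (1 - X ^ (k * (n + 1))) :=
  prod_range_succ _ _

theorem isUnit_qprod {k : ℕ} (hk : 1 ≤ k) (n : ℕ) : IsUnit (qprod k n) := by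
  have hk0 : k ≠ 0 := by omega
  rw [isUnit_iff_constantCoeff, qprod]
  simp [map_prod, hk0]

theorem X_pow_dvd_qprod_sub (k n m : ℕ) :
    (X : ℤ⟦X⟧) ^ (k * (n + 1)) ∣ qprod k (n + m) - qprod k n := by
  induction m with
  | zero => simp
  | succ m ih =>
    have h : qprod k (n + (m + 1)) - qprod k n = (qprod k (n + m) - qprod k n)
        - X ^ (k * (n + 1)) * (X ^ (k * m) * qprod k (n + m)) := by
      rw [← add_assoc, qprod_succ]
      ring
    rw [h]
    exact dvd_sub ih (dvd_mul_right _ _)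

section

open scoped PowerSeries.WithPiTopology
open Filter Topology

theorem X_pow_dvd_f_sub {k : ℕ} (hk : 1 ≤ k) (n : ℕ) :
    (X : ℤ⟦X⟧) ^ (k * (n + 1)) ∣ f k - qprod k n := by
  rw [X_pow_dvd_iff]
  intro m hm
  have h1 : Tendsto (fun N => qprod k N) atTop (𝓝 (f k)) := by
    refine (multipliable_f hk).hasProd.tendsto_prod_nat.congr fun N => ?_
    exact prod_congr rfl fun i _ => by ring
  have h2 := ((WithPiTopology.continuous_coeff ℤ m).tendsto _).comp h1
  have h3 : Tendsto (fun N => coeff m (qprod k N)) atTop (𝓝 (coeff m (qprod k n))) := by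
    refine tendsto_const_nhds.congr' ?_
    filter_upwards [eventually_ge_atTop n] with N hN
    obtain ⟨r, rfl⟩ := Nat.exists_eq_add_of_le hN
    have := X_pow_dvd_iff.mp (X_pow_dvd_qprod_sub k n r) m hm
    rw [map_sub, sub_eq_zero] at this
    exact this.symm
  rw [map_sub, sub_eq_zero]
  exact tendsto_nhds_unique h2 h3

end

/-! ### Truncation modulo powers of q, theta series and q ↦ q^c. -/

/-- Reduction of power series modulo `X ^ n`. -/
noncomputable abbrev modX (n : ℕ) : ℤ⟦X⟧ →+* ℤ⟦X⟧ ⧸ Ideal.span {(X : ℤ⟦X⟧) ^ n} :=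
  Ideal.Quotient.mk _

theorem modX_eq_iff {n : ℕ} {A B : ℤ⟦X⟧} : modX n A = modX n B ↔ X ^ n ∣ A - B := by
  rw [Ideal.Quotient.mk_eq_mk_iff_sub_mem, Ideal.mem_span_singleton]

theorem eq_of_modX_succ {A B : ℤ⟦X⟧} (h : ∀ n, modX (n + 1) A = modX (n + 1) B) : A = B := by
  ext m
  have := X_pow_dvd_iff.mp (modX_eq_iff.mp (h m)) m (Nat.lt_succ_self m)
  rwa [map_sub, sub_eq_zero] at this

theorem modX_f {k : ℕ} (hk : 1 ≤ k) (n : ℕ) : modX (n + 1) (f k) = modX (n + 1) (qprod k n) :=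
  modX_eq_iff.mpr ((pow_dvd_pow _ (Nat.le_mul_of_pos_left _ hk)).trans (X_pow_dvd_f_sub hk n))

/-- The series `∑ k, a k * q ^ t k`, for an exponent function with `k ≤ t k`. -/
noncomputable def theta (a : ℕ → ℤ) (t : ℕ → ℕ) : ℤ⟦X⟧ :=
  mk fun e => ∑ k ∈ range (e + 1), if t k = e then a k else 0

theorem modX_theta (a : ℕ → ℤ) {t : ℕ → ℕ} (ht : ∀ k, k ≤ t k) (n : ℕ) :
    modX (n + 1) (theta a t) = modX (n + 1) (∑ k ∈ range (n + 1), (a k : ℤ⟦X⟧) * X ^ t k) := by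
  rw [modX_eq_iff, X_pow_dvd_iff]
  intro m hm
  rw [map_sub, sub_eq_zero, map_sum, theta, coeff_mk]
  have h : ∀ k, coeff m ((a k : ℤ⟦X⟧) * X ^ t k) = if t k = m then a k else 0 := by
    intro k
    rw [← map_intCast (C (R := ℤ)), coeff_C_mul, coeff_X_pow]
    simp [eq_comm]
  simp_rw [h]
  refine sum_subset (range_mono (by omega)) fun k _ hk => if_neg fun he => hk ?_
  have := ht k
  rw [mem_range]
  omega

theorem coeff_theta (a : ℕ → ℤ) {t : ℕ → ℕ} (ht : ∀ k, k ≤ t k) (hi : Function.Injective t)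
    (k : ℕ) : coeff (t k) (theta a t) = a k := by
  rw [theta, coeff_mk, sum_eq_single k]
  · simp
  · intro m _ hm
    exact if_neg fun h => hm (hi h)
  · intro h
    exact absurd (mem_range.mpr (Nat.lt_succ_of_le (ht k))) h

theorem exists_of_coeff_theta_ne_zero {a : ℕ → ℤ} {t : ℕ → ℕ} {e : ℕ}
    (h : coeff e (theta a t) ≠ 0) : ∃ k, t k = e := by
  rw [theta, coeff_mk] at h
  obtain ⟨k, -, hk⟩ := exists_ne_zero_of_sum_ne_zero h
  exact ⟨k, by by_contra hne; exact hk (if_neg hne)⟩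

theorem expand_qprod {c : ℕ} (hc : c ≠ 0) (k n : ℕ) :
    expand c hc (qprod k n) = qprod (c * k) n := by
  simp [qprod, map_prod, ← pow_mul, mul_assoc]

theorem X_pow_dvd_expand {c : ℕ} (hc : c ≠ 0) {n : ℕ} {A : ℤ⟦X⟧} (h : X ^ n ∣ A) :
    X ^ n ∣ expand c hc A := by
  obtain ⟨B, rfl⟩ := h
  rw [map_mul, map_pow, expand_X, ← pow_mul]
  exact Dvd.dvd.mul_right (pow_dvd_pow _ (Nat.le_mul_of_pos_left _ (Nat.pos_of_ne_zero hc))) _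

theorem modX_expand {c : ℕ} (hc : c ≠ 0) {n : ℕ} {A B : ℤ⟦X⟧} (h : modX n A = modX n B) :
    modX n (expand c hc A) = modX n (expand c hc B) := by
  rw [modX_eq_iff, ← map_sub]
  exact X_pow_dvd_expand hc (modX_eq_iff.mp h)

theorem expand_f {c k : ℕ} (hc : c ≠ 0) (hk : 1 ≤ k) : expand c hc (f k) = f (c * k) := by
  refine eq_of_modX_succ fun n => ?_
  rw [modX_expand hc (modX_f hk n), expand_qprod, modX_f (Nat.mul_pos (Nat.pos_of_ne_zero hc) hk)]

theorem expand_theta {c : ℕ} (hc : c ≠ 0) (a : ℕ → ℤ) {t : ℕ → ℕ} (ht : ∀ k, k ≤ t k) :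
    expand c hc (theta a t) = theta a fun k => c * t k := by
  refine eq_of_modX_succ fun n => ?_
  rw [modX_expand hc (modX_theta a ht n), modX_theta a fun k =>
    (ht k).trans (Nat.le_mul_of_pos_left _ (Nat.pos_of_ne_zero hc))]
  simp [map_sum, pow_mul]

/-! ### Finite forms of the triple product. -/

/-- The coefficients, for `k ≥ 0`, of the finite triple product
`∏_{i=1}^n (1 - z q^i) (1 - z⁻¹ q^i) · (1 - z⁻¹) = ∑_{k ≥ 0} tripleOdd n k (z^k - z^(-k-1))`. -/
noncomputable def tripleOdd : ℕ → ℕ → ℤ⟦X⟧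
  | 0, 0 => 1
  | 0, _ + 1 => 0
  | n + 1, 0 => (1 + X ^ (n + 1) + X ^ (2 * (n + 1))) * tripleOdd n 0
      - X ^ (n + 1) * tripleOdd n 1
  | n + 1, k + 1 => (1 + X ^ (2 * (n + 1))) * tripleOdd n (k + 1)
      - X ^ (n + 1) * (tripleOdd n k + tripleOdd n (k + 2))

theorem tripleOdd_eq_zero {n k : ℕ} (h : n < k) : tripleOdd n k = 0 := by
  induction n generalizing k with
  | zero => obtain ⟨k, rfl⟩ := Nat.exists_eq_succ_of_ne_zero h.ne'; rfl
  | succ n ih =>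
    obtain ⟨k, rfl⟩ := Nat.exists_eq_succ_of_ne_zero (by omega : k ≠ 0)
    rw [tripleOdd, ih (by omega), ih (by omega), ih (by omega)]
    ring

/-- Up to sign and a power of q, the coefficients are q-binomials; the closed form satisfies the
recurrence in n. Writing j for n - k and clearing denominators avoids subtraction and division. -/
theorem tripleOdd_mul_qprod (n : ℕ) : ∀ k j, k + j = n →
    tripleOdd n k * qprod 1 j * qprod 1 (2 * k + j + 1) =
      (-1) ^ k * X ^ tri k * qprod 1 (2 * n + 1) := by
  induction n with
  | zero =>
    intro k j h
    obtain ⟨rfl, rfl⟩ : k = 0 ∧ j = 0 := by omega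
    simp [tripleOdd, tri]
  | succ n ih =>
    intro k j h
    obtain _ | k := k
    · obtain rfl : j = n + 1 := by omega
      have h0 := ih 0 n (by omega)
      have e : 2 * (n + 1) + 1 = 2 * n + 1 + 1 + 1 := by ring
      obtain _ | n := n
      · simp only [tripleOdd, tri, qprod_succ, qprod_zero]
        simp
        ring
      · have h1 := ih 1 n (by omega)
        rw [tripleOdd, e, qprod_succ 1 (2 * (n + 1) + 1 + 1), qprod_succ 1 (2 * (n + 1) + 1)]
        rw [show 2 * 0 + (n + 1) + 1 = n + 1 + 1 by ring] at h0
        rw [show 2 * 1 + n + 1 = n + 1 + 1 + 1 by ring] at h1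
        rw [show 2 * 0 + (n + 1 + 1) + 1 = n + 1 + 1 + 1 by ring]
        simp only [qprod_succ 1 (n + 1 + 1), qprod_succ 1 (n + 1), qprod_succ 1 n, tri,
          one_mul] at h0 h1 ⊢
        norm_num at h0 h1 ⊢
        linear_combination (1 + X ^ (n + 2) + X ^ (2 * (n + 2))) * (1 - X ^ (n + 2))
            * (1 - X ^ (n + 3)) * h0
          - X ^ (n + 2) * (1 - X ^ (n + 1)) * (1 - X ^ (n + 2)) * h1
    · obtain rfl : n = k + j := by omega
      have hk := ih k j rfl
      -- The recurrence uses entries k, k+1, k+2 of row k + j; those beyond the row vanish, so j = 0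
      -- and j = 1 are separate.
      obtain rfl | rfl | ⟨j, rfl⟩ : j = 0 ∨ j = 1 ∨ ∃ i, j = i + 2 :=
        match j with
        | 0 => by simp
        | 1 => by simp
        | i + 2 => by simp
      · simp only [add_zero] at hk ⊢
        rw [tripleOdd, tripleOdd_eq_zero (show k < k + 1 by omega),
          tripleOdd_eq_zero (show k < k + 2 by omega)]
        rw [show 2 * (k + 1) + 1 = 2 * k + 1 + 1 + 1 by ring, tri_succ]
        simp only [qprod_succ 1 (2 * k + 1 + 1), qprod_succ 1 (2 * k + 1)]
        linear_combination (- X ^ (k + 1)) * (1 - X ^ (2 * k + 2)) * (1 - X ^ (2 * k + 3)) * hk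
      · have hk1 := ih (k + 1) 0 (by omega)
        rw [tripleOdd, tripleOdd_eq_zero (show k + 1 < k + 2 by omega)]
        rw [show 2 * (k + 1) + 1 = 2 * k + 1 + 1 + 1 by ring] at hk
        rw [show 2 * (k + 1 + 1) + 1 = 2 * k + 1 + 1 + 1 + 1 + 1 by ring, tri_succ]
        rw [show 2 * (k + 1) + 0 + 1 = 2 * k + 1 + 1 + 1 by ring, tri_succ] at hk1
        rw [show 2 * (k + 1) + 1 + 1 = 2 * k + 1 + 1 + 1 + 1 by ring]
        simp only [qprod_succ 1 (2 * k + 1 + 1 + 1 + 1), qprod_succ 1 (2 * k + 1 + 1 + 1),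
          qprod_succ 1 (2 * k + 1 + 1),
          qprod_succ 1 0, qprod_zero] at hk hk1 ⊢
        linear_combination (1 + X ^ (2 * (k + 2))) * (1 - X) * (1 - X ^ (2 * k + 4)) * hk1
          - X ^ (k + 2) * (1 - X ^ (2 * k + 3)) * (1 - X ^ (2 * k + 4)) * hk
      · have hk1 := ih (k + 1) (j + 1) (by omega)
        have hk2 := ih (k + 2) j (by omega)
        rw [tripleOdd]
        rw [show 2 * (k + (j + 2) + 1) + 1 = 2 * (k + (j + 2)) + 1 + 1 + 1 by ring,
          tri_succ]
        rw [show 2 * (k + 1) + (j + 1) + 1 = 2 * k + (j + 2) + 1 + 1 by ring,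
          tri_succ] at hk1
        rw [show 2 * (k + 2) + j + 1 = 2 * k + (j + 2) + 1 + 1 + 1 by ring,
          tri_succ, tri_succ] at hk2
        rw [show 2 * (k + 1) + (j + 2) + 1 = 2 * k + (j + 2) + 1 + 1 + 1 by ring]
        simp only [qprod_succ 1 (2 * k + (j + 2) + 1 + 1),
          qprod_succ 1 (2 * k + (j + 2) + 1),
          qprod_succ 1 (2 * (k + (j + 2)) + 1 + 1),
          qprod_succ 1 (2 * (k + (j + 2)) + 1),
          qprod_succ 1 (j + 1), qprod_succ 1 j] at hk hk1 hk2 ⊢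
        linear_combination (1 + X ^ (2 * (k + j + 3))) * (1 - X ^ (j + 2))
            * (1 - X ^ (2 * k + j + 5)) * hk1
          - X ^ (k + j + 3) * (1 - X ^ (2 * k + j + 4)) * (1 - X ^ (2 * k + j + 5)) * hk
          - X ^ (k + j + 3) * (1 - X ^ (j + 1)) * (1 - X ^ (j + 2)) * hk2

/-- The coefficients, for `k ≥ 0`, of the finite triple product
`∏_{i=1}^n (1 - z q^(2i-1)) (1 - z⁻¹ q^(2i-1)) = ∑_{k ∈ ℤ} tripleEven n |k| z^k`. -/
noncomputable def tripleEven : ℕ → ℕ → ℤ⟦X⟧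
  | 0, 0 => 1
  | 0, _ + 1 => 0
  | n + 1, 0 => (1 + X ^ (2 * (2 * n + 1))) * tripleEven n 0
      - 2 * X ^ (2 * n + 1) * tripleEven n 1
  | n + 1, k + 1 => (1 + X ^ (2 * (2 * n + 1))) * tripleEven n (k + 1)
      - X ^ (2 * n + 1) * (tripleEven n k + tripleEven n (k + 2))

theorem tripleEven_eq_zero {n k : ℕ} (h : n < k) : tripleEven n k = 0 := by
  induction n generalizing k with
  | zero => obtain ⟨k, rfl⟩ := Nat.exists_eq_succ_of_ne_zero h.ne'; rfl
  | succ n ih =>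
    obtain ⟨k, rfl⟩ := Nat.exists_eq_succ_of_ne_zero (by omega : k ≠ 0)
    rw [tripleEven, ih (by omega), ih (by omega), ih (by omega)]
    ring

theorem tripleEven_mul_qprod (n : ℕ) : ∀ k j, k + j = n →
    tripleEven n k * qprod 2 j * qprod 2 (2 * k + j) =
      (-1) ^ k * X ^ (k ^ 2) * qprod 2 (2 * n) := by
  induction n with
  | zero =>
    intro k j h
    obtain ⟨rfl, rfl⟩ : k = 0 ∧ j = 0 := by omega
    simp [tripleEven]
  | succ n ih =>
    intro k j h
    obtain _ | k := k
    · obtain rfl : j = n + 1 := by omega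
      have h0 := ih 0 n (by omega)
      obtain _ | n := n
      · simp only [tripleEven, qprod_succ, qprod_zero]
        simp
        ring
      · have h1 := ih 1 n (by omega)
        rw [tripleEven, show 2 * (n + 1 + 1) = 2 * (n + 1) + 1 + 1 by ring,
          qprod_succ 2 (2 * (n + 1) + 1), qprod_succ 2 (2 * (n + 1))]
        rw [show 2 * 0 + (n + 1) = n + 1 by ring] at h0
        rw [show 2 * 1 + n = n + 1 + 1 by ring] at h1
        rw [show 2 * 0 + (n + 1 + 1) = n + 1 + 1 by ring]
        simp only [qprod_succ 2 (n + 1), qprod_succ 2 n] at h0 h1 ⊢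
        norm_num at h0 h1 ⊢
        linear_combination (1 + X ^ (2 * (2 * n + 3))) * (1 - X ^ (2 * (n + 2))) ^ 2 * h0
          - 2 * X ^ (2 * n + 3) * (1 - X ^ (2 * (n + 1))) * (1 - X ^ (2 * (n + 2))) * h1
    · obtain rfl : n = k + j := by omega
      have hk := ih k j rfl
      obtain rfl | rfl | ⟨j, rfl⟩ : j = 0 ∨ j = 1 ∨ ∃ i, j = i + 2 :=
        match j with
        | 0 => by simp
        | 1 => by simp
        | i + 2 => by simp
      · simp only [add_zero] at hk ⊢
        rw [tripleEven, tripleEven_eq_zero (show k < k + 1 by omega),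
          tripleEven_eq_zero (show k < k + 2 by omega)]
        rw [show 2 * (k + 1) = 2 * k + 1 + 1 by ring]
        simp only [qprod_succ 2 (2 * k + 1), qprod_succ 2 (2 * k)]
        linear_combination (- X ^ (2 * k + 1)) * (1 - X ^ (4 * k + 2)) * (1 - X ^ (4 * k + 4)) * hk
      · have hk1 := ih (k + 1) 0 (by omega)
        rw [tripleEven, tripleEven_eq_zero (show k + 1 < k + 2 by omega)]
        rw [show 2 * (k + 1) = 2 * k + 1 + 1 by ring] at hk
        rw [show 2 * (k + 1 + 1) = 2 * k + 1 + 1 + 1 + 1 by ring]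
        rw [show 2 * (k + 1) + 0 = 2 * k + 1 + 1 by ring,
          show 2 * (k + 1) = 2 * k + 1 + 1 by ring] at hk1
        rw [show 2 * (k + 1) + 1 = 2 * k + 1 + 1 + 1 by ring]
        simp only [qprod_succ 2 (2 * k + 1 + 1 + 1), qprod_succ 2 (2 * k + 1 + 1),
          qprod_succ 2 (2 * k + 1),
          qprod_succ 2 0, qprod_zero] at hk hk1 ⊢
        linear_combination (1 + X ^ (2 * (2 * k + 3))) * (1 - X ^ 2) * (1 - X ^ (4 * k + 6)) * hk1
          - X ^ (2 * k + 3) * (1 - X ^ (4 * k + 4)) * (1 - X ^ (4 * k + 6)) * hk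
      · have hk1 := ih (k + 1) (j + 1) (by omega)
        have hk2 := ih (k + 2) j (by omega)
        rw [tripleEven]
        rw [show 2 * (k + (j + 2) + 1) = 2 * (k + (j + 2)) + 1 + 1 by ring]
        rw [show 2 * (k + 1) + (j + 1) = 2 * k + (j + 2) + 1 by ring] at hk1
        rw [show 2 * (k + 2) + j = 2 * k + (j + 2) + 1 + 1 by ring] at hk2
        rw [show 2 * (k + 1) + (j + 2) = 2 * k + (j + 2) + 1 + 1 by ring]
        simp only [qprod_succ 2 (2 * k + (j + 2) + 1),
          qprod_succ 2 (2 * k + (j + 2)),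
          qprod_succ 2 (2 * (k + (j + 2)) + 1),
          qprod_succ 2 (2 * (k + (j + 2))),
          qprod_succ 2 (j + 1), qprod_succ 2 j] at hk hk1 hk2 ⊢
        linear_combination (1 + X ^ (2 * (2 * (k + j) + 5))) * (1 - X ^ (2 * j + 4))
            * (1 - X ^ (4 * k + 2 * j + 8)) * hk1
          - X ^ (2 * (k + j) + 5) * (1 - X ^ (4 * k + 2 * j + 6))
            * (1 - X ^ (4 * k + 2 * j + 8)) * hk
          - X ^ (2 * (k + j) + 5) * (1 - X ^ (2 * j + 2)) * (1 - X ^ (2 * j + 4)) * hk2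

/-- The weight 2k+1 is the limit of (z^k - z^(-k-1))/(1 - z⁻¹) as z → 1. The last term is the
boundary error of truncating at m; it vanishes when n < m. -/
theorem sum_tripleOdd_succ (n m : ℕ) :
    ∑ k ∈ range (m + 1), (2 * k + 1) * tripleOdd (n + 1) k =
      (1 - X ^ (n + 1)) ^ 2 * ∑ k ∈ range (m + 1), (2 * k + 1) * tripleOdd n k
        - X ^ (n + 1) *
          ((2 * (m : ℤ⟦X⟧) + 1) * tripleOdd n (m + 1) - (2 * (m : ℤ⟦X⟧) + 3) * tripleOdd n m) := by
  induction m with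
  | zero =>
    simp only [sum_range_succ, sum_range_zero, tripleOdd]
    push_cast
    ring
  | succ m ih =>
    rw [sum_range_succ, ih, sum_range_succ _ (m + 1), tripleOdd]
    push_cast
    ring

theorem sum_tripleOdd (n m : ℕ) (h : n ≤ m) :
    ∑ k ∈ range (m + 1), (2 * k + 1) * tripleOdd n k = qprod 1 n ^ 2 := by
  induction n with
  | zero =>
    rw [sum_range_succ', sum_eq_zero fun k _ => by rw [tripleOdd_eq_zero k.succ_pos, mul_zero]]
    simp [tripleOdd]
  | succ n ih =>
    rw [sum_tripleOdd_succ, ih (by omega), tripleOdd_eq_zero (by omega : n < m + 1),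
      tripleOdd_eq_zero (by omega : n < m), qprod_succ]
    ring

/-- This is the specialisation z = -1, where z^k - z^(-k-1) = 2(-1)^k and the common factor 2
cancels. -/
theorem alternating_sum_tripleOdd_succ (n m : ℕ) :
    ∑ k ∈ range (m + 1), (-1) ^ k * tripleOdd (n + 1) k =
      (1 + X ^ (n + 1)) ^ 2 * ∑ k ∈ range (m + 1), (-1) ^ k * tripleOdd n k
        - X ^ (n + 1) * (-1) ^ m * (tripleOdd n (m + 1) + tripleOdd n m) := by
  induction m with
  | zero =>
    simp only [sum_range_succ, sum_range_zero, tripleOdd]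
    ring
  | succ m ih =>
    rw [sum_range_succ, ih, sum_range_succ _ (m + 1), tripleOdd]
    ring

theorem alternating_sum_tripleOdd (n m : ℕ) (h : n ≤ m) :
    qprod 1 n ^ 2 * ∑ k ∈ range (m + 1), (-1) ^ k * tripleOdd n k = qprod 2 n ^ 2 := by
  induction n with
  | zero =>
    rw [sum_range_succ', sum_eq_zero fun k _ => by rw [tripleOdd_eq_zero k.succ_pos, mul_zero]]
    simp [tripleOdd]
  | succ n ih =>
    rw [alternating_sum_tripleOdd_succ, tripleOdd_eq_zero (by omega : n < m + 1),
      tripleOdd_eq_zero (by omega : n < m), qprod_succ, qprod_succ]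
    linear_combination (1 - X ^ (2 * (n + 1))) ^ 2 * ih (by omega)

/-- This is the specialisation z = 1, with the terms ±k paired. -/
theorem sum_tripleEven_succ (n m : ℕ) :
    tripleEven (n + 1) 0 + 2 * ∑ k ∈ range m, tripleEven (n + 1) (k + 1) =
      (1 - X ^ (2 * n + 1)) ^ 2 * (tripleEven n 0 + 2 * ∑ k ∈ range m, tripleEven n (k + 1))
        - 2 * X ^ (2 * n + 1) * (tripleEven n (m + 1) - tripleEven n m) := by
  induction m with
  | zero =>
    simp only [sum_range_zero, tripleEven]
    ring
  | succ m ih =>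
    rw [sum_range_succ, mul_add, ← add_assoc, ih, sum_range_succ _ m, tripleEven]
    ring

theorem sum_tripleEven (n m : ℕ) (h : n ≤ m) :
    qprod 2 n ^ 2 * (tripleEven n 0 + 2 * ∑ k ∈ range m, tripleEven n (k + 1)) =
      qprod 1 (2 * n) ^ 2 := by
  induction n with
  | zero =>
    rw [sum_eq_zero fun k _ => tripleEven_eq_zero k.succ_pos]
    simp [tripleEven]
  | succ n ih =>
    rw [sum_tripleEven_succ, tripleEven_eq_zero (by omega : n < m + 1),
      tripleEven_eq_zero (by omega : n < m), qprod_succ,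
      show 2 * (n + 1) = 2 * n + 1 + 1 by ring, qprod_succ 1, qprod_succ 1]
    linear_combination (1 - X ^ (2 * n + 2)) ^ 2 * (1 - X ^ (2 * n + 1)) ^ 2 * ih (by omega)

/-! ### Passage to the limit: the identities of Jacobi and Gauss. -/

/-- If `Y` is a ratio of `q`-factorials that tends to `X ^ t`, then so is its normalisation. -/
theorem X_pow_dvd_sub_of_mul_eq {b j m N M t e : ℕ} (hb : 1 ≤ b) {Y s : ℤ⟦X⟧} (hj : j ≤ N)
    (hm : j ≤ m) (hM : j ≤ M) (ht : e ≤ t + b * (j + 1))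
    (h : Y * qprod b j * qprod b m = s * X ^ t * qprod b M) :
    X ^ e ∣ qprod b N * Y - s * X ^ t := by
  -- Both products are congruent to `qprod b j ^ 2`, since later factors are 1 to this order.
  have hd : (X : ℤ⟦X⟧) ^ (b * (j + 1)) ∣ qprod b N * qprod b M - qprod b j * qprod b m := by
    obtain ⟨x, rfl⟩ := Nat.exists_eq_add_of_le hj
    obtain ⟨y, rfl⟩ := Nat.exists_eq_add_of_le hm
    obtain ⟨z, rfl⟩ := Nat.exists_eq_add_of_le hM
    have h1 := (X_pow_dvd_qprod_sub b j x).mul_right (qprod b (j + z))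
    have h2 := (X_pow_dvd_qprod_sub b j z).mul_left (qprod b j)
    have h3 := (X_pow_dvd_qprod_sub b j y).mul_left (qprod b j)
    convert dvd_sub (dvd_add h1 h2) h3 using 1
    ring
  rw [← ((isUnit_qprod hb j).mul (isUnit_qprod hb m)).dvd_mul_right]
  have e1 : (qprod b N * Y - s * X ^ t) * (qprod b j * qprod b m) =
      s * (X ^ t * (qprod b N * qprod b M - qprod b j * qprod b m)) := by
    linear_combination qprod b N * h
  rw [e1]
  refine Dvd.dvd.mul_left ((pow_dvd_pow _ ht).trans ?_) _
  rw [pow_add]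
  exact mul_dvd_mul_left _ hd

theorem modX_tripleOdd {n k : ℕ} (h : k ≤ n) :
    modX (n + 1) (qprod 1 n * tripleOdd n k) = modX (n + 1) ((-1) ^ k * X ^ tri k) := by
  obtain ⟨j, rfl⟩ := Nat.exists_eq_add_of_le h
  have := le_tri k
  exact modX_eq_iff.mpr (X_pow_dvd_sub_of_mul_eq le_rfl (by omega) (by omega) (by omega)
    (by omega) (tripleOdd_mul_qprod _ k j rfl))

theorem modX_tripleEven {n k : ℕ} (h : k ≤ n) :
    modX (n + 1) (qprod 2 n * tripleEven n k) = modX (n + 1) ((-1) ^ k * X ^ (k ^ 2)) := by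
  obtain ⟨j, rfl⟩ := Nat.exists_eq_add_of_le h
  exact modX_eq_iff.mpr (X_pow_dvd_sub_of_mul_eq (by norm_num) (by omega) (by omega) (by omega)
    (by nlinarith [sq_nonneg ((k : ℤ) - 1), Nat.le_self_pow two_ne_zero k])
    (tripleEven_mul_qprod _ k j rfl))

/-- **Jacobi's identity** `f_1^3 = ∑_{k ≥ 0} (-1)^k (2k+1) q^(k(k+1)/2)`. -/
theorem f_one_pow_three : f 1 ^ 3 = theta (fun k => (-1) ^ k * (2 * k + 1)) tri := by
  refine eq_of_modX_succ fun n => ?_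
  have e : qprod 1 n ^ 3 = qprod 1 n * ∑ k ∈ range (n + 1), (2 * k + 1) * tripleOdd n k := by
    rw [sum_tripleOdd n n le_rfl]
    ring
  rw [map_pow, modX_f le_rfl, modX_theta _ le_tri, ← map_pow, e, mul_sum, map_sum, map_sum]
  refine sum_congr rfl fun k hk => ?_
  rw [mul_left_comm, map_mul, modX_tripleOdd (Nat.lt_succ_iff.mp (mem_range.mp hk)), ← map_mul]
  push_cast
  ring_nf

/-- **Gauss's identity** `f_2^2 / f_1 = ∑_{k ≥ 0} q^(k(k+1)/2)`. -/
theorem f_one_mul_theta_tri : f 1 * theta (fun _ => 1) tri = f 2 ^ 2 := by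
  refine eq_of_modX_succ fun n => ?_
  have h : modX (n + 1) (qprod 1 n * ∑ k ∈ range (n + 1), (-1) ^ k * tripleOdd n k) =
      modX (n + 1) (∑ k ∈ range (n + 1), ((1 : ℤ) : ℤ⟦X⟧) * X ^ tri k) := by
    rw [mul_sum, map_sum, map_sum]
    refine sum_congr rfl fun k hk => ?_
    rw [mul_left_comm, map_mul, modX_tripleOdd (Nat.lt_succ_iff.mp (mem_range.mp hk)), ← map_mul,
      ← mul_assoc, ← mul_pow]
    simp
  rw [map_mul, map_pow, modX_f le_rfl, modX_f (by norm_num), modX_theta _ le_tri, ← h, ← map_mul,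
    ← map_pow, ← alternating_sum_tripleOdd n n le_rfl]
  ring_nf

/-- **Gauss's identity** `f_1^2 / f_2 = ∑_{k ∈ ℤ} (-1)^k q^(k^2)`. -/
theorem f_two_mul_theta_sq :
    f 2 * theta (fun k => if k = 0 then 1 else 2 * (-1) ^ k) (fun k => k ^ 2) = f 1 ^ 2 := by
  refine eq_of_modX_succ fun n => ?_
  have h : modX (n + 1) (qprod 2 n *
      (tripleEven n 0 + 2 * ∑ k ∈ range n, tripleEven n (k + 1))) =
      modX (n + 1) (∑ k ∈ range (n + 1),
        ((if k = 0 then 1 else 2 * (-1) ^ k : ℤ) : ℤ⟦X⟧) * X ^ (k ^ 2)) := by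
    rw [sum_range_succ', mul_add, map_add, map_add, modX_tripleEven n.zero_le, mul_left_comm,
      mul_sum, mul_sum, map_sum, map_sum]
    refine (congrArg₂ (· + ·) (by simp) (sum_congr rfl fun k hk => ?_)).trans (add_comm _ _)
    rw [map_mul, modX_tripleEven (mem_range.mp hk), ← map_mul, if_neg k.succ_ne_zero]
    push_cast
    rw [mul_assoc]
  have h1 : modX (n + 1) (f 1) = modX (n + 1) (qprod 1 (2 * n)) :=
    modX_eq_iff.mpr ((pow_dvd_pow _ (by omega)).trans (X_pow_dvd_f_sub le_rfl (2 * n)))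
  rw [map_mul, map_pow, h1, modX_f (by norm_num),
    modX_theta _ (fun k => Nat.le_self_pow two_ne_zero k), ← h, ← map_mul,
    ← map_pow, ← sum_tripleEven n n le_rfl]
  ring_nf

/-! ### Exponents modulo 5. -/

/-- Multiplying by 8 and adding 1 gives (2k+1)^2 + 8m^2 ≡ 0 mod 5; as 2 is a non-residue, 2k+1 and m
both vanish mod 5. -/
theorem mod_five_of_tri_add_sq {k m : ℕ} (h : (tri k + m ^ 2) % 5 = 3) :
    k % 5 = 2 ∧ m % 5 = 0 := by
  have h2 := two_mul_tri k
  have h3 : (k * (k + 1) + 2 * m ^ 2) % 5 = 1 := by omega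
  have hk : k % 5 < 5 := Nat.mod_lt _ (by norm_num)
  have hm : m % 5 < 5 := Nat.mod_lt _ (by norm_num)
  rw [Nat.add_mod, Nat.mul_mod, Nat.add_mod k, Nat.mul_mod 2, Nat.pow_mod] at h3
  generalize k % 5 = a at *
  generalize m % 5 = b at *
  interval_cases a <;> interval_cases b <;> simp_all

/-- Multiplying by 8 and adding 3 gives 2(2k+1)^2 + (2m+1)^2 ≡ 0 mod 5, and -2 is a non-residue. -/
theorem mod_five_of_two_mul_tri_add_tri {k m : ℕ} (h : (2 * tri k + tri m) % 5 = 4) :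
    k % 5 = 2 ∧ m % 5 = 2 := by
  have h2 := two_mul_tri k
  have h3 := two_mul_tri m
  have h3 : (2 * (k * (k + 1)) + m * (m + 1)) % 5 = 3 := by omega
  have hk : k % 5 < 5 := Nat.mod_lt _ (by norm_num)
  have hm : m % 5 < 5 := Nat.mod_lt _ (by norm_num)
  rw [Nat.add_mod, Nat.mul_mod 2, Nat.mul_mod k, Nat.mul_mod m, Nat.add_mod k, Nat.add_mod m] at h3
  generalize k % 5 = a at *
  generalize m % 5 = b at *
  interval_cases a <;> interval_cases b <;> simp_all

theorem tri_five_mul_add_two (k : ℕ) : tri (5 * k + 2) = 25 * tri k + 3 := by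
  have h1 := two_mul_tri k
  have h2 := two_mul_tri (5 * k + 2)
  nlinarith

open Classical in
/-- Suppose that the terms of the product of two lattice series whose exponent is `≡ r + r'`
modulo `5` come only from the indices `≡ d` and `≡ d'` modulo `5`, and that on these indices the
two series reproduce themselves in `q^25`. Then so does the product on those exponents. -/
theorem coeff_theta_mul_theta {a b : ℕ → ℤ} {s t : ℕ → ℕ} {c : ℤ} {d d' r r' : ℕ}
    (hs : ∀ k, k ≤ s k) (ht : ∀ k, k ≤ t k) (his : Function.Injective s)
    (hit : Function.Injective t) (hsd : ∀ k, s (5 * k + d) = 25 * s k + r)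
    (htd : ∀ k, t (5 * k + d') = 25 * t k + r') (ha : ∀ k, a (5 * k + d) = c * a k)
    (hb : ∀ k, b (5 * k + d') = b k)
    (hst : ∀ k m, (s k + t m) % 5 = (r + r') % 5 → k % 5 = d ∧ m % 5 = d')
    {e : ℕ} (he : e % 5 = (r + r') % 5) :
    coeff e (theta a s * theta b t) =
      coeff e ((c : ℤ⟦X⟧) * X ^ (r + r') *
        expand 25 (by norm_num) (theta a s * theta b t)) := by
  have key : ∀ (a : ℕ → ℤ) (s : ℕ → ℕ) (c : ℤ) (r i : ℕ),
      coeff i ((c : ℤ⟦X⟧) * X ^ r * expand 25 (by norm_num) (theta a s)) =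
        if ∃ i', i = 25 * i' + r then c * coeff ((i - r) / 25) (theta a s) else 0 := by
    intro a s c r i
    rw [mul_assoc, ← map_intCast (C (R := ℤ)), coeff_C_mul, coeff_X_pow_mul', coeff_expand]
    by_cases h : ∃ i', i = 25 * i' + r
    · obtain ⟨i', rfl⟩ := h
      simp
    · rw [if_neg h]
      split_ifs with h1 h2
      · exact absurd ⟨(i - r) / 25, by omega⟩ h
      · simp
      · simp
  have e1 : (c : ℤ⟦X⟧) * X ^ (r + r') * expand 25 (by norm_num) (theta a s * theta b t) =
      ((c : ℤ⟦X⟧) * X ^ r * expand 25 (by norm_num) (theta a s)) *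
        (((1 : ℤ) : ℤ⟦X⟧) * X ^ r' * expand 25 (by norm_num) (theta b t)) := by
    rw [map_mul]
    push_cast
    ring
  have hval : ∀ (a : ℕ → ℤ) (s : ℕ → ℕ) (c : ℤ) (d r : ℕ), (∀ k, k ≤ s k) →
      Function.Injective s → (∀ k, s (5 * k + d) = 25 * s k + r) →
      (∀ k, a (5 * k + d) = c * a k) → (∀ k, s k % 25 = r % 25 → k % 5 = d) →
      ∀ i, coeff (25 * i + r) (theta a s) = c * coeff i (theta a s) := by
    intro a s c d r hs his hsd ha hr i
    by_cases h : ∃ k, s k = i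
    · obtain ⟨k, rfl⟩ := h
      rw [← hsd, coeff_theta a hs his, coeff_theta a hs his, ha]
    · have h1 : coeff i (theta a s) = 0 := by
        by_contra h2
        exact h (exists_of_coeff_theta_ne_zero h2)
      rw [h1, mul_zero]
      by_contra h2
      obtain ⟨k, hk⟩ := exists_of_coeff_theta_ne_zero h2
      have hkd := hr k (by omega)
      have h3 := hsd (k / 5)
      rw [← hkd, Nat.div_add_mod] at h3
      exact h ⟨k / 5, by omega⟩
  -- Pairing k with the index d', whose exponent is ≡ r' mod 25, brings the condition on one series
  -- under `hst`.
  have hs5 : ∀ k, s k % 25 = r % 25 → k % 5 = d := fun k hk =>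
    (hst k d' (by have := htd 0; rw [mul_zero, zero_add] at this; omega)).1
  have ht5 : ∀ m, t m % 25 = r' % 25 → m % 5 = d' := fun m hm =>
    (hst d m (by have := hsd 0; rw [mul_zero, zero_add] at this; omega)).2
  rw [e1, coeff_mul, coeff_mul]
  refine sum_congr rfl fun p hp => ?_
  obtain ⟨i, j⟩ := p
  rw [HasAntidiagonal.mem_antidiagonal] at hp
  simp only at hp ⊢
  rw [key, key]
  by_cases h : (∃ i', i = 25 * i' + r) ∧ ∃ j', j = 25 * j' + r'
  · rw [if_pos h.1, if_pos h.2]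
    obtain ⟨⟨i', rfl⟩, j', rfl⟩ := h
    rw [hval a s c d r hs his hsd ha hs5,
      hval b t 1 d' r' ht hit htd (fun k => by rw [hb, one_mul]) ht5]
    simp
  · have h0 : coeff i (theta a s) * coeff j (theta b t) = 0 := by
      by_contra hne
      obtain ⟨h1, h2⟩ := mul_ne_zero_iff.mp hne
      obtain ⟨k, rfl⟩ := exists_of_coeff_theta_ne_zero h1
      obtain ⟨m, rfl⟩ := exists_of_coeff_theta_ne_zero h2
      obtain ⟨hk, hm⟩ := hst k m (by omega)
      refine h ⟨⟨s (k / 5), ?_⟩, t (m / 5), ?_⟩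
      · rw [← hsd, ← hk, Nat.div_add_mod]
      · rw [← htd, ← hm, Nat.div_add_mod]
    rw [h0]
    rcases not_and_or.mp h with h | h
    · rw [if_neg h, zero_mul]
    · rw [if_neg h, mul_zero]

/-! ### The operator U and its action on ψ and φ. -/

/-- The operator `∑ a(n) q^n ↦ ∑ a(5n+4) q^n`. -/
noncomputable def sectionFour (F : ℤ⟦X⟧) : ℤ⟦X⟧ :=
  mk fun n => coeff (5 * n + 4) F

theorem sectionFour_mul_expand (F G : ℤ⟦X⟧) :
    sectionFour (F * expand 5 (by norm_num) G) = sectionFour F * G := by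
  ext n
  rw [sectionFour, coeff_mk, coeff_mul, coeff_mul]
  symm
  refine sum_of_injOn (fun p => (5 * p.1 + 4, 5 * p.2)) ?_ ?_ ?_ ?_
  · rintro ⟨i, j⟩ - ⟨i', j'⟩ - h
    simp only [Prod.mk.injEq] at h ⊢
    omega
  · rintro ⟨i, j⟩ h
    rw [mem_coe, HasAntidiagonal.mem_antidiagonal] at h ⊢
    simp only at h ⊢
    omega
  · rintro ⟨i, j⟩ h h'
    rw [HasAntidiagonal.mem_antidiagonal] at h
    simp only at h ⊢
    rw [coeff_expand_of_not_dvd, mul_zero]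
    rintro ⟨j', rfl⟩
    replace h : i + 5 * j' = 5 * n + 4 := h
    refine h' ⟨(n - j', j'), ?_, ?_⟩
    · rw [mem_coe, HasAntidiagonal.mem_antidiagonal]
      exact Nat.sub_add_cancel (by omega)
    · simp only [Prod.mk.injEq, and_true]
      omega
  · rintro ⟨i, j⟩ -
    simp only [sectionFour, coeff_mk, coeff_expand_mul]

/-- If `F` and `q^4 G(q^5)` agree in degrees `≡ 4` modulo `5`, then the section of `F` is `G`. -/
theorem sectionFour_eq_of_coeff {F G : ℤ⟦X⟧}
    (h : ∀ e, e % 5 = 4 → coeff e F = coeff e (X ^ 4 * expand 5 (by norm_num) G)) :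
    sectionFour F = G := by
  ext n
  rw [sectionFour, coeff_mk, h _ (by omega), coeff_X_pow_mul, coeff_expand_mul]

/-- The series `f_2^5 / f_1`. -/
noncomputable def psiSeries : ℤ⟦X⟧ :=
  theta (fun k => (-1) ^ k * (2 * k + 1)) (fun k => 2 * tri k) * theta (fun _ => 1) tri

/-- The series `f_1^5 / f_2`. -/
noncomputable def phiSeries : ℤ⟦X⟧ :=
  theta (fun k => (-1) ^ k * (2 * k + 1)) tri *
    theta (fun k => if k = 0 then 1 else 2 * (-1) ^ k) (fun k => k ^ 2)

theorem f_two_mul_phiSeries : f 2 * phiSeries = f 1 ^ 5 := by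
  rw [phiSeries, ← f_one_pow_three, mul_left_comm, f_two_mul_theta_sq]
  ring

theorem f_one_mul_psiSeries : f 1 * psiSeries = f 2 ^ 5 := by
  have h := congrArg (expand 2 two_ne_zero) f_one_pow_three
  rw [map_pow, expand_f _ le_rfl, expand_theta _ _ le_tri] at h
  rw [psiSeries, ← h, mul_left_comm, f_one_mul_theta_tri]
  ring

theorem sectionFour_psiSeries :
    sectionFour psiSeries = 5 * X * expand 5 (by norm_num) psiSeries := by
  refine sectionFour_eq_of_coeff fun e he => ?_
  have h := coeff_theta_mul_theta (a := fun k => (-1) ^ k * (2 * k + 1)) (b := fun _ => 1)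
    (s := fun k => 2 * tri k) (t := tri) (c := 5) (d := 2) (d' := 2) (r := 6) (r' := 3)
    (fun k => by have := le_tri k; omega) le_tri
    (fun k m h => tri_injective (Nat.eq_of_mul_eq_mul_left two_pos h)) tri_injective
    (fun k => by rw [tri_five_mul_add_two]; ring) tri_five_mul_add_two
    (fun k => by
      have : (-1 : ℤ) ^ (5 * k + 2) = (-1) ^ k := by
        rw [pow_add, pow_mul]; norm_num
      rw [this]; push_cast; ring)
    (fun _ => rfl) (fun k m hkm => mod_five_of_two_mul_tri_add_tri hkm) (e := e) he
  -- Here q^9 ψ(q^25) = q^4 · (q ψ) evaluated at q^5.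
  rw [psiSeries, h, map_mul (expand 5 _), map_mul (expand 5 _) 5, expand_X, ← expand_mul, map_ofNat]
  congr 1
  push_cast
  ring

theorem sectionFour_X_mul_phiSeries :
    sectionFour (X * phiSeries) = 5 * expand 5 (by norm_num) phiSeries := by
  refine sectionFour_eq_of_coeff fun e he => ?_
  -- The factor q shifts the residue 4 to 3 for φ itself.
  obtain ⟨e, rfl⟩ := Nat.exists_eq_succ_of_ne_zero (by omega : e ≠ 0)
  have h := coeff_theta_mul_theta (a := fun k => (-1) ^ k * (2 * k + 1))
    (b := fun k => if k = 0 then 1 else 2 * (-1) ^ k)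
    (s := tri) (t := fun k => k ^ 2) (c := 5) (d := 2) (d' := 0) (r := 3) (r' := 0)
    le_tri (fun k => Nat.le_self_pow two_ne_zero k) tri_injective
    (Nat.pow_left_injective two_ne_zero) tri_five_mul_add_two (fun k => by ring)
    (fun k => by
      have : (-1 : ℤ) ^ (5 * k + 2) = (-1) ^ k := by
        rw [pow_add, pow_mul]; norm_num
      rw [this]; push_cast; ring)
    (fun k => by
      have : (-1 : ℤ) ^ (5 * k) = (-1) ^ k := by
        rw [pow_mul]; norm_num
      simp [this])
    (fun k m hkm => mod_five_of_tri_add_sq hkm) (e := e) (by omega)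
  rw [phiSeries, Nat.succ_eq_add_one, mul_comm X, coeff_succ_mul_X, h, map_mul (expand 5 _) 5,
    ← expand_mul, map_ofNat, ← coeff_succ_mul_X]
  congr 1
  push_cast
  ring

/-! ### Factorisation of the two quotients and iteration of U. -/

theorem eq_quot {A B F : ℤ⟦X⟧} (hB : constantCoeff B = 1) (h : F * B = A) : quot A B = F := by
  have hne : B ≠ 0 := fun h0 => by simp [h0] at hB
  exact mul_right_cancel₀ hne ((quot_mul_cancel A hB).trans h.symm)

theorem expand_five_phiSeries_mul :
    expand 5 (by norm_num) phiSeries * f 10 = f 5 ^ 5 := by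
  have h := congrArg (expand 5 (by norm_num)) f_two_mul_phiSeries
  rw [map_mul, map_pow, expand_f (by norm_num) (by norm_num),
    expand_f (by norm_num) (by norm_num)] at h
  rw [mul_comm]
  exact h

theorem expand_five_psiSeries_mul :
    expand 5 (by norm_num) psiSeries * f 5 = f 10 ^ 5 := by
  have h := congrArg (expand 5 (by norm_num)) f_one_mul_psiSeries
  rw [map_mul, map_pow, expand_f (by norm_num) (by norm_num),
    expand_f (by norm_num) (by norm_num)] at h
  rw [mul_comm]
  exact h

theorem quot_two_five : quot (f 2 ^ 5 * f 5 ^ 5) (f 1 * f 10) =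
    psiSeries * expand 5 (by norm_num) phiSeries := by
  refine eq_quot ?_ ?_
  · rw [map_mul, constantCoeff_f le_rfl, constantCoeff_f (by norm_num), one_mul]
  · rw [← f_one_mul_psiSeries, ← expand_five_phiSeries_mul]
    ring

theorem quot_one_ten : quot (f 1 ^ 5 * f 10 ^ 5) (f 2 * f 5) =
    phiSeries * expand 5 (by norm_num) psiSeries := by
  refine eq_quot ?_ ?_
  · rw [map_mul, constantCoeff_f (by norm_num), constantCoeff_f (by norm_num), one_mul]
  · rw [← f_two_mul_phiSeries, ← expand_five_psiSeries_mul]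
    ring

theorem sectionFour_five_pow_mul (n : ℕ) (F : ℤ⟦X⟧) :
    sectionFour (5 ^ n * F) = 5 ^ n * sectionFour F := by
  ext m
  have h : (5 : ℤ⟦X⟧) ^ n = C (5 ^ n) := by simp
  rw [h, sectionFour, coeff_mk, coeff_C_mul, coeff_C_mul, sectionFour, coeff_mk]

theorem sectionFour_Psi (α : ℕ) : sectionFour (Psi α) = 5 * Psi (α + 1) := by
  rcases Nat.even_or_odd α with h | h
  · rw [Psi, Psi, if_neg (Nat.not_odd_iff_even.mpr h), if_pos h.add_one, quot_two_five,
      quot_one_ten, sectionFour_mul_expand, sectionFour_psiSeries]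
    ring
  · rw [Psi, Psi, if_pos h, if_neg (Nat.not_odd_iff_even.mpr h.add_one), quot_two_five,
      quot_one_ten, ← mul_assoc, sectionFour_mul_expand, sectionFour_X_mul_phiSeries]
    ring

/-- Induction starts at α = 0, which is the definition of M; U sends index 5^α n + 5^α - 1 to the
next one because 5^α(5n+4) + 5^α = 5^(α+1)(n+1). -/
theorem mk_M_eq (α : ℕ) :
    mk (fun n : ℕ => M (5 ^ α * n + 5 ^ α - 1)) = (5 : ℤ⟦X⟧) ^ α * Psi α := by
  induction α with
  | zero =>
    ext n
    simp [M, Psi]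
  | succ α ih =>
    rw [pow_succ (5 : ℤ⟦X⟧), mul_assoc, ← sectionFour_Psi, ← sectionFour_five_pow_mul, ← ih]
    ext n
    rw [sectionFour, coeff_mk, coeff_mk, coeff_mk]
    congr 1
    rw [pow_succ]
    have := Nat.one_le_pow α 5 (by norm_num)
    have e : 5 ^ α * (5 * n + 4) + 5 ^ α = 5 ^ α * 5 * n + 5 ^ α * 5 := by ring
    rw [e]

end QSeries

theorem theorem1p3 (α : ℕ) (hα : 1 ≤ α) :
    PowerSeries.mk (fun n : ℕ => QSeries.M (5 ^ α * n + 5 ^ α - 1)) =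
      (5 : PowerSeries ℤ) ^ α * QSeries.Psi α :=
  QSeries.mk_M_eq α
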